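/- Let $N\ge 2$ and $\beta>0$. Let $D=\{x=(x_1,\dots,x_N)\in(\mathbb R^2)^N : x_i\neq x_j \text{ for all } i\neq j\}$, and for $x\in D$ let $$H(x)=\frac1N\sum_{i=1}^N|x_i|^2+\frac1{2N^2}\sum_{1\le i\ne j\le N}\log\frac1{|x_i-x_j|^2},$$ where $|\cdot|$ is the Euclidean norm and the last sum runs over ordered pairs. Let $Z_N=\int_D e^{-\beta H(x)}\,dx$ and let $P^N$ be the measure on $(\mathbb R^2)^N$ which has density $e^{-\beta H}/Z_N$ on $D$ with respect to the Lebesgue measure and vanishes outside $D$. Let $\mathcal F$ be the set of $C^\infty$ functions $f:D\to\mathbb R$ such that the closure of $\{x\in D: f(x)\neq0\}$ is compact and included in $D$. Then $P^N$ is a probability measure, and it satisfies a Poincaré inequality on $\mathcal F$: there is a constant $c>0$, which may depend on $N$ and $\beta$, such that for every $f\in\mathcal F$, $$\int f^2\,dP^N-\Big(\int f\,dP^N\Big)^2\le c\int|\nabla f|^2\,dP^N,$$ where $\nabla$ is the gradient in $(\mathbb R^2)^N\equiv\mathbb R^{2N}$. -/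

import Mathlib

open MeasureTheory
open scoped ContDiff

namespace CoulombGas

noncomputable section

/-- The plane `ℝ²` with its Euclidean norm. -/
abbrev Plane : Type := EuclideanSpace ℝ (Fin 2)

/-- The space `(ℝ²)^N ≡ ℝ^{2N}` with the Euclidean norm `|x|² = ∑ i, |x i|²`; its `volume` is the
Lebesgue measure. -/
abbrev Config (N : ℕ) : Type := PiLp 2 (fun _ : Fin N => Plane)

/-- The open set `D ⊆ (ℝ²)^N` of configurations of pairwise distinct points. -/
def domain (N : ℕ) : Set (Config N) := {x | ∀ i j : Fin N, i ≠ j → x i ≠ x j}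

/-- The quadratic confinement potential `V z = |z|²`. -/
def confinement (z : Plane) : ℝ := ‖z‖ ^ 2

/-- The Coulomb interaction potential `W z = log (1 / |z|²)`; only used for `z ≠ 0`. -/
def interaction (z : Plane) : ℝ := Real.log (1 / ‖z‖ ^ 2)

/-- The energy `H x = N⁻¹ ∑ i, V (x i) + (2 N²)⁻¹ ∑ (i ≠ j), W (x i - x j)`,
the last sum running over ordered pairs. -/
def energy (N : ℕ) (x : Config N) : ℝ :=
  1 / (N : ℝ) * ∑ i : Fin N, confinement (x i)
    + 1 / (2 * (N : ℝ) ^ 2) *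
      ∑ i : Fin N, ∑ j ∈ Finset.univ.filter (fun j : Fin N => i ≠ j), interaction (x i - x j)

/-- The partition function `Z_N = ∫_D exp (- β H)`. -/
def partitionFunction (N : ℕ) (β : ℝ) : ℝ :=
  ∫ x in domain N, Real.exp (-β * energy N x)

/-- The Boltzmann–Gibbs measure `P^N` on `(ℝ²)^N`: density `exp (- β H) / Z_N` on `D` with respect
to the Lebesgue measure, extended by zero outside of `D`. -/
def boltzmannGibbs (N : ℕ) (β : ℝ) : Measure (Config N) :=
  (volume.restrict (domain N)).withDensity
    (fun x => ENNReal.ofReal (Real.exp (-β * energy N x) / partitionFunction N β))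

/-- The class of `C^∞` functions on the open set `S` with compact support in `S`: the closure of
`{x ∈ S | f x ≠ 0}` is compact and included in `S`. A function on `S` is represented by a function
on the whole space, whose values outside of `S` play no role. -/
def testFunctions {E : Type*} [NormedAddCommGroup E] [NormedSpace ℝ E] (S : Set E) :
    Set (E → ℝ) :=
  {f | ContDiffOn ℝ ∞ f S ∧ IsCompact (closure {x | x ∈ S ∧ f x ≠ 0}) ∧
    closure {x | x ∈ S ∧ f x ≠ 0} ⊆ S}

/-- `μ` satisfies a Poincaré inequality on the class `F` with constant `c`:
`E_μ (f²) - (E_μ f)² ≤ c E_μ (|∇f|²)` for every `f` in `F`. -/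
def SatisfiesPoincare {E : Type*} [NormedAddCommGroup E] [InnerProductSpace ℝ E] [CompleteSpace E]
    [MeasurableSpace E] (μ : Measure E) (F : Set (E → ℝ)) (c : ℝ) : Prop :=
  ∀ f ∈ F, (∫ x, f x ^ 2 ∂μ) - (∫ x, f x ∂μ) ^ 2 ≤ c * ∫ x, ‖gradient f x‖ ^ 2 ∂μ

end

end CoulombGas

/-! ### Poincaré inequality on a convex set -/

section Segment

open Set ENNReal Real

/-! Twice the variance is the double integral of `(f x - f y)²`, which can be estimated piece by
piece over a cover of `D`. The energy is not convex, but `D` is a finite union of open convex cells,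
on each of which every difference `x i - x j` stays in a fixed quadrant.

Within a cell, corresponding differences of two configurations have positive inner product. Hence
moving from `y` at most halfway towards `x` at worst halves each distance, and the interaction grows
by at most a constant (`interaction_segment_le`). Integrating the gradient along segments, cut at
the midpoint, then gives the inequality on a cell (`lintegral_enorm_sub_sq_le_of_convex`); the
Gaussian confinement absorbs the length of the segments.

Two sets meeting in positive measure can be compared through their intersection. Since `D` is
connected, chains of overlapping cells link all of them (`PoincareRel.of_isPreconnected`).
Connectedness uses the dimension 2 of the plane: generic segments avoid collisions. Finally `D` has
full measure, and a test function extends smoothly by zero. -/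

theorem sq_lintegral_enorm_le {α F : Type*} [MeasurableSpace α] [NormedAddCommGroup F]
    {μ : Measure α} [IsProbabilityMeasure μ] {g : α → F} (hg : AEStronglyMeasurable g μ) :
    (∫⁻ s, ‖g s‖ₑ ∂μ) ^ 2 ≤ ∫⁻ s, ‖g s‖ₑ ^ 2 ∂μ := by
  have h := eLpNorm'_le_eLpNorm'_of_exponent_le (p := 1) (q := 2) one_pos (by norm_num) μ hg
  simp only [eLpNorm', ENNReal.rpow_one, div_one, ENNReal.rpow_two] at h
  calc _ ≤ ((∫⁻ s, ‖g s‖ₑ ^ 2 ∂μ) ^ (1 / 2 : ℝ)) ^ 2 := by gcongr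
    _ = _ := by
      rw [← ENNReal.rpow_two, ← ENNReal.rpow_mul]; norm_num

theorem enorm_sub_sq_le_two_mul (a b c : ℝ) :
    ‖a - c‖ₑ ^ 2 ≤ 2 * ‖a - b‖ₑ ^ 2 + 2 * ‖b - c‖ₑ ^ 2 := by
  have h := ENNReal.rpow_add_le_mul_rpow_add_rpow ‖a - b‖ₑ ‖b - c‖ₑ (p := 2) (by norm_num)
  have e : (2 : ℝ≥0∞) ^ ((2 : ℝ) - 1) = 2 := by norm_num
  rw [e, ENNReal.rpow_two, ENNReal.rpow_two, ENNReal.rpow_two, mul_add] at h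
  refine le_trans ?_ h
  gcongr
  rw [← sub_add_sub_cancel a b c]
  exact enorm_add_le _ _

theorem enorm_sub_sq_le_lintegral_deriv {h : ℝ → ℝ} (hh : ContDiff ℝ 1 h) :
    ‖h 1 - h 0‖ₑ ^ 2 ≤ ∫⁻ s in Icc (0 : ℝ) 1, ‖deriv h s‖ₑ ^ 2 := by
  have : IsProbabilityMeasure (volume.restrict (Icc (0 : ℝ) 1)) := ⟨by simp⟩
  refine le_trans ?_ (sq_lintegral_enorm_le (hh.continuous_deriv le_rfl).aestronglyMeasurable)
  gcongr
  exact enorm_sub_le_lintegral_deriv_of_contDiffOn_Icc hh.contDiffOn zero_le_one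

variable {E : Type*} [NormedAddCommGroup E] [InnerProductSpace ℝ E]

/-- The half segment is run through as `s ^ 2 / 2`, so that the speed `s • v` vanishes at `y`. The
resulting factor `s ^ 2` is what makes `segment_weight_le` uniform in `y`. -/
theorem enorm_sub_midpoint_sq_le {f : E → ℝ} (hf : ContDiff ℝ 1 f) (y v : E) :
    ‖f (y + (1 / 2 : ℝ) • v) - f y‖ₑ ^ 2 ≤
      ∫⁻ s in Icc (0 : ℝ) 1, ‖fderiv ℝ f (y + (s ^ 2 / 2) • v)‖ₑ ^ 2 * ‖s • v‖ₑ ^ 2 := by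
  have hγ : ∀ s : ℝ, HasDerivAt (fun s : ℝ => y + (s ^ 2 / 2) • v) (s • v) s := by
    intro s
    have h1 : HasDerivAt (fun s : ℝ => s ^ 2 / 2) s s := by
      simpa using (hasDerivAt_pow 2 s).div_const 2
    exact (h1.smul_const v).const_add y
  have hd : ∀ s : ℝ, deriv (fun s : ℝ => f (y + (s ^ 2 / 2) • v)) s =
      fderiv ℝ f (y + (s ^ 2 / 2) • v) (s • v) := fun s =>
    (((hf.differentiable one_ne_zero _).hasFDerivAt).comp_hasDerivAt s (hγ s)).deriv
  have hc : ContDiff ℝ 1 (fun s : ℝ => f (y + (s ^ 2 / 2) • v)) := by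
    refine hf.comp ?_
    fun_prop
  have := enorm_sub_sq_le_lintegral_deriv hc
  simp only [hd] at this
  refine le_trans (le_of_eq (by norm_num)) (this.trans ?_)
  refine lintegral_mono fun s => ?_
  rw [← mul_pow]
  gcongr
  exact (fderiv ℝ f _).le_opENorm _

theorem norm_sq_segment_le (x y : E) {t : ℝ} (h0 : 0 ≤ t) (h1 : t ≤ 1) :
    ‖y + t • (x - y)‖ ^ 2 ≤ (1 - t) * ‖y‖ ^ 2 + t * ‖x‖ ^ 2 := by
  have h2 : ‖y + t • (x - y)‖ ^ 2 = (1 - t) * ‖y‖ ^ 2 + t * ‖x‖ ^ 2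
      - t * (1 - t) * ‖x - y‖ ^ 2 := by
    rw [norm_add_sq_real, norm_smul, norm_sub_sq_real, inner_smul_right, inner_sub_right,
      real_inner_self_eq_norm_sq, mul_pow, norm_sub_sq_real, real_inner_comm x y,
      Real.norm_eq_abs, sq_abs]
    ring
  rw [h2]
  have : 0 ≤ t * (1 - t) * ‖x - y‖ ^ 2 := by
    have := sub_nonneg.2 h1
    positivity
  linarith

/-- By convexity of the squared norm, replacing `y` by the intermediate point gains `exp (-q)` with
`q = a * s ^ 2 * ‖y‖ ^ 2 / 2`, at the cost of half the Gaussian decay in `x`. The squared speed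
depends on `y` only through a multiple of `q`, and `q * exp (-q)` is bounded. -/
theorem segment_weight_le {I : E → ℝ} {a M : ℝ} (ha : 0 < a) {x y : E} {s : ℝ} (h0 : 0 ≤ s)
    (h1 : s ≤ 1) (hM : I y ≤ I (y + (s ^ 2 / 2) • (x - y)) + M) :
    ‖s • (x - y)‖ ^ 2 * (exp (I x - a * ‖x‖ ^ 2) * exp (I y - a * ‖y‖ ^ 2)) ≤
      (2 * ‖x‖ ^ 2 + 4 / a) * exp (I x + M - a / 2 * ‖x‖ ^ 2) *
        exp (I (y + (s ^ 2 / 2) • (x - y)) - a * ‖y + (s ^ 2 / 2) • (x - y)‖ ^ 2) := by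
  have hs : s ^ 2 ≤ 1 := pow_le_one₀ h0 h1
  have hu := norm_sq_segment_le x y (t := s ^ 2 / 2) (by positivity) (by linarith)
  set u := y + (s ^ 2 / 2) • (x - y)
  set q := a / 2 * (s ^ 2 * ‖y‖ ^ 2) with hq
  have hq0 : 0 ≤ q := by positivity
  have hsq : ‖s • (x - y)‖ ^ 2 ≤ 2 * ‖x‖ ^ 2 + 4 / a * q := by
    have e1 : ‖x - y‖ ^ 2 ≤ 2 * ‖x‖ ^ 2 + 2 * ‖y‖ ^ 2 := by
      have := parallelogram_law_with_norm ℝ x y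
      nlinarith [sq_nonneg ‖x + y‖]
    have e2 : 4 / a * q = 2 * (s ^ 2 * ‖y‖ ^ 2) := by rw [hq]; field_simp; ring
    rw [e2, norm_smul, mul_pow, Real.norm_eq_abs, sq_abs]
    nlinarith [mul_le_mul_of_nonneg_left e1 (sq_nonneg s),
      mul_le_mul_of_nonneg_right hs (sq_nonneg ‖x‖)]
  have hexp : exp (I x - a * ‖x‖ ^ 2) * exp (I y - a * ‖y‖ ^ 2) ≤
      exp (-q) * (exp (I x + M - a / 2 * ‖x‖ ^ 2) * exp (I u - a * ‖u‖ ^ 2)) := by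
    rw [← exp_add, ← exp_add, ← exp_add, exp_le_exp]
    have e3 : a * ‖u‖ ^ 2 ≤ a * ((1 - s ^ 2 / 2) * ‖y‖ ^ 2 + s ^ 2 / 2 * ‖x‖ ^ 2) := by gcongr
    have e4 : a * (s ^ 2 * ‖x‖ ^ 2) ≤ a * (1 * ‖x‖ ^ 2) := by gcongr
    rw [hq]
    nlinarith
  have hqe : (2 * ‖x‖ ^ 2 + 4 / a * q) * exp (-q) ≤ 2 * ‖x‖ ^ 2 + 4 / a := by
    have e5 : exp (-q) ≤ 1 := exp_le_one_iff.2 (by linarith)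
    have e6 : q * exp (-q) ≤ 1 := by
      rw [exp_neg, ← div_eq_mul_inv, div_le_one (exp_pos q)]
      linarith [add_one_le_exp q]
    have : 0 ≤ 4 / a := by positivity
    nlinarith [mul_le_mul_of_nonneg_left e5 (by positivity : 0 ≤ 2 * ‖x‖ ^ 2),
      mul_le_mul_of_nonneg_left e6 this]
  calc _ ≤ (2 * ‖x‖ ^ 2 + 4 / a * q) *
        (exp (-q) * (exp (I x + M - a / 2 * ‖x‖ ^ 2) * exp (I u - a * ‖u‖ ^ 2))) := by gcongr
    _ = ((2 * ‖x‖ ^ 2 + 4 / a * q) * exp (-q)) *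
        (exp (I x + M - a / 2 * ‖x‖ ^ 2) * exp (I u - a * ‖u‖ ^ 2)) := by ring
    _ ≤ (2 * ‖x‖ ^ 2 + 4 / a) *
        (exp (I x + M - a / 2 * ‖x‖ ^ 2) * exp (I u - a * ‖u‖ ^ 2)) := by gcongr
    _ = _ := by ring

variable [FiniteDimensional ℝ E] [MeasurableSpace E] [BorelSpace E]

/-- For fixed `x` the map is a homothety of ratio `1 - t ≥ 1 / 2`, so its inverse has Jacobian at
most `2 ^ dim`. This is why segments are cut at the midpoint. -/
theorem lintegral_comp_homothety_le (F : E → ℝ≥0∞) (x : E) {t : ℝ} (ht : t ≤ 1 / 2) :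
    ∫⁻ y, F (y + t • (x - y)) ≤ 2 ^ Module.finrank ℝ E * ∫⁻ y, F y := by
  have hr : (1 - t) ≠ 0 := by linarith
  have h1 : ∀ y : E, y + t • (x - y) = (1 - t) • y + t • x := fun y => by module
  simp only [h1]
  have h2 := (Homeomorph.smulOfNeZero (1 - t) hr).measurableEmbedding.lintegral_map
    (μ := (volume : Measure E)) (fun y => F (y + t • x))
  simp only [Homeomorph.smulOfNeZero_apply] at h2
  rw [← h2, Measure.map_addHaar_smul _ hr, lintegral_smul_measure, lintegral_add_right_eq_self, smul_eq_mul]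
  gcongr
  rw [← ENNReal.ofReal_ofNat 2, ← ENNReal.ofReal_pow (by norm_num)]
  apply ENNReal.ofReal_le_ofReal
  have : 0 < 1 - t := by linarith
  rw [abs_of_nonneg (by positivity), ← inv_pow]
  gcongr
  rw [inv_le_comm₀ this (by norm_num)]
  linarith

/-- A Poincaré inequality on a convex set, with an unspecified constant: along the segment from
`x` to `y`, the density at each point controls the density at the closer end point. -/
theorem lintegral_enorm_sub_sq_le_of_convex {μ : Measure E} {A : Set E} (hA : MeasurableSet A)
    (hconv : Convex ℝ A) {I : E → ℝ} (hI : Measurable I) {a M : ℝ} (ha : 0 < a)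
    (hM : ∀ x ∈ A, ∀ y ∈ A, ∀ t ∈ Icc (0 : ℝ) (1 / 2), I y ≤ I (y + t • (x - y)) + M)
    (hμ : μ.restrict A = (volume.restrict A).withDensity
      fun x => ENNReal.ofReal (exp (I x - a * ‖x‖ ^ 2)))
    {f : E → ℝ} (hf : ContDiff ℝ 1 f) :
    ∫⁻ x in A, ∫⁻ y in A, ‖f x - f y‖ₑ ^ 2 ∂μ ∂μ ≤
      4 * ((∫⁻ x, ENNReal.ofReal ((2 * ‖x‖ ^ 2 + 4 / a) * exp (I x + M - a / 2 * ‖x‖ ^ 2))) *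
        (2 ^ Module.finrank ℝ E * ∫⁻ x in A, ‖fderiv ℝ f x‖ₑ ^ 2 ∂μ)) := by
  set ρ : E → ℝ≥0∞ := fun x => ENNReal.ofReal (exp (I x - a * ‖x‖ ^ 2)) with hρ
  set G : E → ℝ≥0∞ := fun x =>
    ENNReal.ofReal ((2 * ‖x‖ ^ 2 + 4 / a) * exp (I x + M - a / 2 * ‖x‖ ^ 2))
  have hρm : Measurable ρ := by fun_prop
  have hGm : Measurable G := by fun_prop
  have hdm : Measurable (fun x => ‖fderiv ℝ f x‖ₑ ^ 2) :=
    ((hf.continuous_fderiv one_ne_zero).enorm.measurable).pow_const 2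
  set g : E → ℝ≥0∞ := fun x => ‖fderiv ℝ f x‖ₑ ^ 2 with hg
  set K : E → E → ℝ≥0∞ := fun x y => ∫⁻ s in Icc (0 : ℝ) 1,
    g (y + (s ^ 2 / 2) • (x - y)) * ‖s • (x - y)‖ₑ ^ 2 with hK
  have hKm : Measurable (Function.uncurry K) := by
    apply Measurable.lintegral_prod_right' (f := fun p : (E × E) × ℝ =>
      g (p.1.2 + (p.2 ^ 2 / 2) • (p.1.1 - p.1.2)) * ‖p.2 • (p.1.1 - p.1.2)‖ₑ ^ 2)
    fun_prop
  have hpt : ∀ x y, ‖f x - f y‖ₑ ^ 2 ≤ 2 * K x y + 2 * K y x := by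
    intro x y
    have k1 := enorm_sub_midpoint_sq_le hf y (x - y)
    have k2 := enorm_sub_midpoint_sq_le hf x (y - x)
    have e : x + (1 / 2 : ℝ) • (y - x) = y + (1 / 2 : ℝ) • (x - y) := by module
    rw [e] at k2
    have k3 := enorm_sub_sq_le_two_mul (f x) (f (y + (1 / 2 : ℝ) • (x - y))) (f y)
    rw [← enorm_neg, neg_sub] at k2
    rw [add_comm (2 * K x y)]
    exact k3.trans (by gcongr)
  set ν := (volume.restrict A).withDensity ρ with hν
  set W := 2 ^ Module.finrank ℝ E * ∫⁻ x in A, g x ∂μ with hW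
  have hgm : ∫⁻ x in A, g x ∂μ = ∫⁻ x in A, ρ x * g x := by
    rw [hμ, hν, lintegral_withDensity_eq_lintegral_mul _ hρm hdm]
    rfl
  have hslice : ∀ x ∈ A, ∀ s ∈ Icc (0 : ℝ) 1,
      ∫⁻ y in A, ρ x * ρ y * (g (y + (s ^ 2 / 2) • (x - y)) * ‖s • (x - y)‖ₑ ^ 2) ≤ G x * W := by
    intro x hx s hs
    have hs2 : s ^ 2 ≤ 1 := pow_le_one₀ hs.1 hs.2
    have hs3 : s ^ 2 / 2 ∈ Icc (0 : ℝ) (1 / 2) := ⟨by positivity, by linarith⟩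
    -- Convexity keeps the intermediate point in `A`; extending by zero allows the change of
    -- variables on the whole space.
    calc _ ≤ ∫⁻ y in A, G x * A.indicator (fun u => ρ u * g u) (y + (s ^ 2 / 2) • (x - y)) := by
          refine setLIntegral_mono' hA fun y hy => ?_
          have hu : y + (s ^ 2 / 2) • (x - y) ∈ A :=
            hconv.add_smul_sub_mem hy hx ⟨hs3.1, by linarith [hs3.2]⟩
          rw [indicator_of_mem hu]
          have hw := ENNReal.ofReal_le_ofReal
            (segment_weight_le ha hs.1 hs.2 (hM x hx y hy _ hs3))
          rw [ENNReal.ofReal_mul (by positivity), ENNReal.ofReal_mul (by positivity),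
            ENNReal.ofReal_mul (by positivity), ENNReal.ofReal_pow (norm_nonneg _),
            ofReal_norm] at hw
          calc _ = (‖s • (x - y)‖ₑ ^ 2 * (ρ x * ρ y)) * g (y + (s ^ 2 / 2) • (x - y)) := by ring
            _ ≤ (G x * ρ (y + (s ^ 2 / 2) • (x - y))) * g (y + (s ^ 2 / 2) • (x - y)) := by
              gcongr
            _ = _ := by ring
      _ ≤ ∫⁻ y, G x * A.indicator (fun u => ρ u * g u) (y + (s ^ 2 / 2) • (x - y)) :=
          setLIntegral_le_lintegral _ _
      _ = G x * ∫⁻ y, A.indicator (fun u => ρ u * g u) (y + (s ^ 2 / 2) • (x - y)) :=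
          lintegral_const_mul' _ _ ENNReal.ofReal_ne_top
      _ ≤ G x * (2 ^ Module.finrank ℝ E * ∫⁻ y, A.indicator (fun u => ρ u * g u) y) := by
          gcongr
          exact lintegral_comp_homothety_le _ x hs3.2
      _ = G x * W := by rw [lintegral_indicator hA, hW, hgm]
  have hx : ∀ x ∈ A, ρ x * ∫⁻ y, K x y ∂ν ≤ G x * W := by
    intro x hx
    rw [hν, lintegral_withDensity_eq_lintegral_mul _ hρm
      (show Measurable (K x) from hKm.of_uncurry_left),
      ← lintegral_const_mul' _ _ ENNReal.ofReal_ne_top]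
    calc _ = ∫⁻ y in A, ∫⁻ s in Icc (0 : ℝ) 1,
          ρ x * ρ y * (g (y + (s ^ 2 / 2) • (x - y)) * ‖s • (x - y)‖ₑ ^ 2) := by
          refine lintegral_congr fun y => ?_
          rw [Pi.mul_apply, ← mul_assoc, hK, lintegral_const_mul' _ _
            (ENNReal.mul_ne_top ENNReal.ofReal_ne_top ENNReal.ofReal_ne_top)]
      _ = ∫⁻ s in Icc (0 : ℝ) 1, ∫⁻ y in A,
          ρ x * ρ y * (g (y + (s ^ 2 / 2) • (x - y)) * ‖s • (x - y)‖ₑ ^ 2) := by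
          rw [lintegral_lintegral_swap]
          apply Measurable.aemeasurable
          unfold Function.uncurry
          fun_prop
      _ ≤ ∫⁻ s in Icc (0 : ℝ) 1, G x * W := setLIntegral_mono' measurableSet_Icc (hslice x hx)
      _ = G x * W := by simp
  have hKK : ∫⁻ x, ∫⁻ y, K x y ∂ν ∂ν ≤ (∫⁻ x, G x) * W := by
    have m : Measurable fun x => ∫⁻ y, K x y ∂ν :=
      Measurable.lintegral_prod_right' (f := Function.uncurry K) hKm
    have e := lintegral_withDensity_eq_lintegral_mul (volume.restrict A) hρm m
    rw [← hν] at e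
    rw [e]
    calc _ ≤ ∫⁻ x in A, G x * W := setLIntegral_mono' hA hx
      _ ≤ ∫⁻ x, G x * W := setLIntegral_le_lintegral _ _
      _ = _ := lintegral_mul_const _ hGm
  have hswap : ∫⁻ x, ∫⁻ y, K y x ∂ν ∂ν = ∫⁻ x, ∫⁻ y, K x y ∂ν ∂ν :=
    lintegral_lintegral_swap (hKm.comp measurable_swap).aemeasurable
  rw [hμ]
  calc _ ≤ ∫⁻ x, ∫⁻ y, (2 * K x y + 2 * K y x) ∂ν ∂ν :=
        lintegral_mono fun x => lintegral_mono fun y => hpt x y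
    _ = ∫⁻ x, (2 * ∫⁻ y, K x y ∂ν + 2 * ∫⁻ y, K y x ∂ν) ∂ν := by
        refine lintegral_congr fun x => ?_
        have m1 : Measurable (K x) := hKm.of_uncurry_left
        rw [lintegral_add_left (m1.const_mul 2), lintegral_const_mul' _ _ (by simp),
          lintegral_const_mul' _ _ (by simp)]
    _ = 2 * ∫⁻ x, ∫⁻ y, K x y ∂ν ∂ν + 2 * ∫⁻ x, ∫⁻ y, K y x ∂ν ∂ν := by
        have m2 : Measurable fun x => ∫⁻ y, K x y ∂ν :=
          Measurable.lintegral_prod_right' (f := Function.uncurry K) hKm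
        rw [lintegral_add_left (m2.const_mul 2), lintegral_const_mul' _ _ (by simp),
          lintegral_const_mul' _ _ (by simp)]
    _ = 4 * ∫⁻ x, ∫⁻ y, K x y ∂ν ∂ν := by rw [hswap, ← add_mul]; norm_num
    _ ≤ _ := by gcongr

end Segment

/-! ### Gluing Poincaré inequalities -/

section Gluing

open Set ENNReal Topology

variable {E : Type*} [NormedAddCommGroup E] [NormedSpace ℝ E] [MeasurableSpace E]

/-- The mean square difference of a `C¹` function between `A` and `B` is controlled by its
Dirichlet energy. -/
def PoincareRel (μ : Measure E) (A B : Set E) : Prop :=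
  ∃ c : ℝ≥0∞, c ≠ ⊤ ∧ ∀ f : E → ℝ, ContDiff ℝ 1 f →
    ∫⁻ x in A, ∫⁻ y in B, ‖f x - f y‖ₑ ^ 2 ∂μ ∂μ ≤ c * ∫⁻ x, ‖fderiv ℝ f x‖ₑ ^ 2 ∂μ

namespace PoincareRel

variable {μ : Measure E} {A B C A' B' : Set E}

theorem mono (h : PoincareRel μ A B) (hA : A' ⊆ A) (hB : B' ⊆ B) : PoincareRel μ A' B' := by
  obtain ⟨c, hc, H⟩ := h
  refine ⟨c, hc, fun f hf => le_trans ?_ (H f hf)⟩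
  exact (lintegral_mono_set hA).trans (lintegral_mono fun x => lintegral_mono_set hB)

theorem symm [BorelSpace E] [SecondCountableTopology E] [SFinite μ] (h : PoincareRel μ A B) :
    PoincareRel μ B A := by
  obtain ⟨c, hc, H⟩ := h
  refine ⟨c, hc, fun f hf => le_trans (le_of_eq ?_) (H f hf)⟩
  have hfm : Measurable f := hf.continuous.measurable
  rw [lintegral_lintegral_swap]
  · refine lintegral_congr fun x => lintegral_congr fun y => ?_
    rw [← enorm_neg, neg_sub]
  · apply Measurable.aemeasurable
    unfold Function.uncurry
    fun_prop

/-- Insert an intermediate value `f y` and average over `y ∈ B`; positivity of `μ B` allows the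
final division. -/
theorem trans [BorelSpace E] [SecondCountableTopology E] [IsFiniteMeasure μ] (h₁ : PoincareRel μ A B)
    (h₂ : PoincareRel μ B C) (hB : μ B ≠ 0) : PoincareRel μ A C := by
  obtain ⟨c₁, hc₁, H₁⟩ := h₁.symm
  obtain ⟨c₂, hc₂, H₂⟩ := h₂
  have hfin : ∀ s, μ s ≠ ⊤ := fun s => measure_ne_top μ s
  refine ⟨(μ B)⁻¹ * (2 * μ C * c₁ + 2 * μ A * c₂), ?_, fun f hf => ?_⟩
  · have h1 := hfin A
    have h2 := hfin C
    finiteness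
  have hfm : Measurable f := hf.continuous.measurable
  set Ef := ∫⁻ x, ‖fderiv ℝ f x‖ₑ ^ 2 ∂μ
  set J := ∫⁻ x in A, ∫⁻ z in C, ‖f x - f z‖ₑ ^ 2 ∂μ ∂μ with hJ
  have hy : ∀ y, J ≤ 2 * μ C * ∫⁻ x in A, ‖f y - f x‖ₑ ^ 2 ∂μ
      + 2 * μ A * ∫⁻ z in C, ‖f y - f z‖ₑ ^ 2 ∂μ := by
    intro y
    calc J ≤ ∫⁻ x in A, ∫⁻ z in C, (2 * ‖f y - f x‖ₑ ^ 2 + 2 * ‖f y - f z‖ₑ ^ 2) ∂μ ∂μ := by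
          refine lintegral_mono fun x => lintegral_mono fun z => ?_
          have := enorm_sub_sq_le_two_mul (f x) (f y) (f z)
          rwa [← enorm_neg (f x - f y), neg_sub] at this
      _ = ∫⁻ x in A, (2 * μ C * ‖f y - f x‖ₑ ^ 2 + 2 * ∫⁻ z in C, ‖f y - f z‖ₑ ^ 2 ∂μ) ∂μ := by
          refine lintegral_congr fun x => ?_
          rw [lintegral_add_left measurable_const, lintegral_const,
            Measure.restrict_apply_univ, lintegral_const_mul' _ _ (by simp)]
          ring
      _ = _ := by
          rw [lintegral_add_right _ measurable_const, lintegral_const,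
            Measure.restrict_apply_univ,
            lintegral_const_mul' _ _ (ENNReal.mul_ne_top (by simp) (hfin C))]
          ring
  have hm : Measurable fun y => ∫⁻ x in A, ‖f y - f x‖ₑ ^ 2 ∂μ := by
    apply Measurable.lintegral_prod_right' (f := fun p : E × E => ‖f p.1 - f p.2‖ₑ ^ 2)
    fun_prop
  have hBJ : μ B * J ≤ (2 * μ C * c₁ + 2 * μ A * c₂) * Ef := by
    calc μ B * J = ∫⁻ _ in B, J ∂μ := by simp [mul_comm]
      _ ≤ ∫⁻ y in B, (2 * μ C * ∫⁻ x in A, ‖f y - f x‖ₑ ^ 2 ∂μ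
          + 2 * μ A * ∫⁻ z in C, ‖f y - f z‖ₑ ^ 2 ∂μ) ∂μ := lintegral_mono hy
      _ = 2 * μ C * ∫⁻ y in B, ∫⁻ x in A, ‖f y - f x‖ₑ ^ 2 ∂μ ∂μ
          + 2 * μ A * ∫⁻ y in B, ∫⁻ z in C, ‖f y - f z‖ₑ ^ 2 ∂μ ∂μ := by
          rw [lintegral_add_left (hm.const_mul _),
            lintegral_const_mul' _ _ (ENNReal.mul_ne_top (by simp) (hfin C)),
            lintegral_const_mul' _ _ (ENNReal.mul_ne_top (by simp) (hfin A))]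
      _ ≤ 2 * μ C * (c₁ * Ef) + 2 * μ A * (c₂ * Ef) := by
          gcongr
          · exact H₁ f hf
          · exact H₂ f hf
      _ = _ := by ring
  calc J = (μ B)⁻¹ * (μ B * J) := by
        rw [← mul_assoc, ENNReal.inv_mul_cancel hB (hfin B), one_mul]
    _ ≤ (μ B)⁻¹ * ((2 * μ C * c₁ + 2 * μ A * c₂) * Ef) := by gcongr
    _ = _ := by ring

theorem iUnion_left {ι : Type*} [Finite ι] {A : ι → Set E} (h : ∀ i, PoincareRel μ (A i) B) :
    PoincareRel μ (⋃ i, A i) B := by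
  have := Fintype.ofFinite ι
  choose c hc H using h
  refine ⟨∑ i, c i, by simpa using fun i => hc i, fun f hf => ?_⟩
  refine (lintegral_iUnion_le _ _).trans ?_
  rw [tsum_fintype, Finset.sum_mul]
  exact Finset.sum_le_sum fun i _ => H i f hf

theorem of_inter [BorelSpace E] [SecondCountableTopology E] [IsFiniteMeasure μ] (hA : PoincareRel μ A A)
    (hB : PoincareRel μ B B) (h : μ (A ∩ B) ≠ 0) : PoincareRel μ A B :=
  (hA.mono subset_rfl inter_subset_left).trans (hB.mono inter_subset_right subset_rfl) h

/-- Gluing of Poincaré inequalities along a finite open cover of a preconnected set. -/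
theorem of_isPreconnected [BorelSpace E] [SecondCountableTopology E] [IsFiniteMeasure μ] {ι : Type*} [Finite ι]
    {A : ι → Set E} {D : Set E} (hD : IsPreconnected D) (hA : ∀ i, IsOpen (A i))
    (hDA : D = ⋃ i, A i) (hpos : ∀ U ⊆ D, IsOpen U → U.Nonempty → μ U ≠ 0)
    (h : ∀ i, PoincareRel μ (A i) (A i)) : PoincareRel μ D D := by
  have hAD : ∀ i, A i ⊆ D := fun i => hDA ▸ subset_iUnion A i
  have hinter : ∀ i j x, x ∈ A i → x ∈ A j → PoincareRel μ (A i) (A j) := fun i j x hi hj =>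
    (h i).of_inter (h j) (hpos _ (inter_subset_left.trans (hAD i)) ((hA i).inter (hA j))
      ⟨x, hi, hj⟩)
  have hA0 : ∀ i x, x ∈ A i → μ (A i) ≠ 0 := fun i x hx => hpos _ (hAD i) (hA i) ⟨x, hx⟩
  have key : ∀ x ∈ D, ∀ y ∈ D, ∀ i j, x ∈ A i → y ∈ A j → PoincareRel μ (A i) (A j) := by
    intro x hx y hy
    -- The relation on points quantifies over all members of the cover containing them, so that it
    -- is transitive; locally, everything passes through one `A k` containing both points.
    refine hD.induction₂ (fun x y => ∀ i j, x ∈ A i → y ∈ A j → PoincareRel μ (A i) (A j))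
      ?_ ?_ ?_ hx hy
    · intro x hx
      obtain ⟨k, hk⟩ := mem_iUnion.1 (hDA ▸ hx)
      filter_upwards [mem_nhdsWithin_of_mem_nhds ((hA k).mem_nhds hk)] with y hy i j hi hj
      exact (hinter i k x hi hk).trans (hinter k j y hy hj) (hA0 k x hk)
    · intro x y z _ hy _ hxy hyz i j hi hj
      obtain ⟨k, hk⟩ := mem_iUnion.1 (hDA ▸ hy)
      exact (hxy i k hi hk).trans (hyz k j hk hj) (hA0 k y hk)
    · intro x y _ _ hxy i j hi hj
      exact (hxy j i hj hi).symm
  have hall : ∀ i j, PoincareRel μ (A i) (A j) := by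
    intro i j
    -- Members of the cover may be empty, as cells with incompatible sectors are.
    rcases (A i).eq_empty_or_nonempty with hi | ⟨x, hx⟩
    · exact ⟨0, by simp, fun f _ => by simp [hi]⟩
    rcases (A j).eq_empty_or_nonempty with hj | ⟨y, hy⟩
    · exact ⟨0, by simp, fun f _ => by simp [hj]⟩
    exact key x (hAD i hx) y (hAD j hy) i j hx hy
  rw [hDA]
  exact iUnion_left fun i => (iUnion_left fun j => hall j i).symm

end PoincareRel

end Gluing

namespace CoulombGas

open Set Topology

/-! ### Convex cells and connectedness of the domain -/

section Geometry

/-- An open quadrant of the plane, whose first side is directed by the vector `e`. -/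
def sector (e : SignType × SignType) : Set Plane :=
  {z | 0 < (e.1 : ℝ) * z 0 + (e.2 : ℝ) * z 1 ∧ 0 < (e.1 : ℝ) * z 1 - (e.2 : ℝ) * z 0}

/-- The four open coordinate quadrants miss the axes; the four turned by 45 degrees cover them. The
sector of `(0, 0)` is empty. -/
theorem exists_mem_sector {z : Plane} (hz : z ≠ 0) : ∃ e, z ∈ sector e := by
  have h : z 0 ≠ 0 ∨ z 1 ≠ 0 := by
    by_contra! h
    exact hz (PiLp.ext fun i => by fin_cases i <;> simp [h])
  simp only [sector, mem_ofPred_eq]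
  rcases lt_trichotomy (z 0) 0 with h0 | h0 | h0 <;> rcases lt_trichotomy (z 1) 0 with h1 | h1 | h1
  · exact ⟨(-1, 0), by simp [h0], by simp [h1]⟩
  · exact ⟨(-1, 1), by simp [h0, h1], by simp [h0, h1]⟩
  · exact ⟨(0, 1), by simp [h1], by simp [h0]⟩
  · exact ⟨(-1, -1), by simp [h0, h1], by simp [h0, h1]⟩
  · simp [h0, h1] at h
  · exact ⟨(1, 1), by simp [h0, h1], by simp [h0, h1]⟩
  · exact ⟨(0, -1), by simp [h1], by simp [h0]⟩
  · exact ⟨(1, -1), by simp [h0, h1], by simp [h0, h1]⟩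
  · exact ⟨(1, 0), by simp [h0], by simp [h1]⟩

/-- Uses the planar identity `(e·z)(e·w) + (e×z)(e×w) = |e|² (z·w)`. -/
theorem inner_pos_of_mem_sector {e : SignType × SignType} {z w : Plane} (hz : z ∈ sector e)
    (hw : w ∈ sector e) : 0 < inner ℝ z w := by
  have h1 := mul_pos hz.1 hw.1
  have h2 := mul_pos hz.2 hw.2
  have h3 : inner ℝ z w = z 0 * w 0 + z 1 * w 1 := by
    simp [PiLp.inner_apply, Fin.sum_univ_two, mul_comm]
  have h4 : 0 < ((e.1 : ℝ) ^ 2 + (e.2 : ℝ) ^ 2) * inner ℝ z w := by rw [h3]; linarith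
  exact pos_of_mul_pos_right h4 (by positivity)

theorem convex_sector (e : SignType × SignType) : Convex ℝ (sector e) := by
  intro z hz w hw a b ha hb hab
  simp only [sector, mem_ofPred_eq, PiLp.add_apply, PiLp.smul_apply, smul_eq_mul] at *
  rcases ha.eq_or_lt with rfl | ha
  · obtain rfl : b = 1 := by linarith
    simpa using hw
  · constructor
    · nlinarith [mul_pos ha hz.1, mul_nonneg hb hw.1.le]
    · nlinarith [mul_pos ha hz.2, mul_nonneg hb hw.2.le]

theorem isOpen_sector (e : SignType × SignType) : IsOpen (sector e) := by
  have h1 : IsOpen {z : Plane | 0 < (e.1 : ℝ) * z 0 + (e.2 : ℝ) * z 1} :=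
    isOpen_lt continuous_const (by fun_prop)
  have h2 : IsOpen {z : Plane | 0 < (e.1 : ℝ) * z 1 - (e.2 : ℝ) * z 0} :=
    isOpen_lt continuous_const (by fun_prop)
  exact h1.inter h2

theorem zero_notMem_sector (e : SignType × SignType) : (0 : Plane) ∉ sector e := by
  simp [sector]

/-- Configurations whose differences lie in prescribed sectors. -/
def cell {N : ℕ} (σ : Fin N → Fin N → SignType × SignType) : Set (Config N) :=
  {x | ∀ i j, i ≠ j → x i - x j ∈ sector (σ i j)}

variable {N : ℕ}

theorem isOpen_cell (σ : Fin N → Fin N → SignType × SignType) : IsOpen (cell σ) := by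
  simp only [cell, ofPred_forall]
  refine isOpen_iInter_of_finite fun i => isOpen_iInter_of_finite fun j =>
    isOpen_iInter_of_finite fun _ => ?_
  exact (isOpen_sector _).preimage (f := fun x : Config N => x i - x j) (by fun_prop)

theorem convex_cell (σ : Fin N → Fin N → SignType × SignType) : Convex ℝ (cell σ) := by
  intro x hx y hy a b ha hb hab i j hij
  have := convex_sector _ (hx i j hij) (hy i j hij) ha hb hab
  convert this using 1
  simp only [PiLp.add_apply, PiLp.smul_apply]
  module

theorem domain_eq_iUnion_cell : domain N = ⋃ σ, cell σ := by
  ext x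
  simp only [mem_iUnion]
  constructor
  · intro hx
    have : ∀ i j, ∃ e, i ≠ j → x i - x j ∈ sector e := fun i j => by
      by_cases h : i = j
      · exact ⟨(0, 0), fun h' => absurd h h'⟩
      · obtain ⟨e, he⟩ := exists_mem_sector (sub_ne_zero.2 (hx i j h))
        exact ⟨e, fun _ => he⟩
    choose σ hσ using this
    exact ⟨σ, hσ⟩
  · rintro ⟨σ, hσ⟩ i j hij h
    exact zero_notMem_sector _ (by simpa [h] using hσ i j hij)

theorem isOpen_domain : IsOpen (domain N) := by
  rw [domain_eq_iUnion_cell]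
  exact isOpen_iUnion isOpen_cell

/-- Each forbidden condition defines a proper subspace, because a line is not the whole plane, and a
real vector space is not a finite union of proper subspaces. -/
theorem exists_sub_notMem_span (x y : Config N) : ∃ v : Config N, ∀ i j, i ≠ j →
    v i - v j ∉ Submodule.span ℝ {x i - x j} ∧ v i - v j ∉ Submodule.span ℝ {y i - y j} := by
  let p : {q : Fin N × Fin N // q.1 ≠ q.2} × Bool → Submodule ℝ (Config N) := fun q =>
    (Submodule.span ℝ {bif q.2 then x q.1.1.1 - x q.1.1.2 else y q.1.1.1 - y q.1.1.2}).comap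
      ((PiLp.proj (𝕜 := ℝ) 2 (fun _ : Fin N => Plane) q.1.1.1 -
        PiLp.proj (𝕜 := ℝ) 2 (fun _ : Fin N => Plane) q.1.1.2 : Config N →L[ℝ] Plane) :
        Config N →ₗ[ℝ] Plane)
  have hp : ∀ q, p q ≠ ⊤ := by
    rintro ⟨⟨⟨i, j⟩, hij⟩, b⟩ h
    set u : Plane := bif b then x i - x j else y i - y j with hu
    have hspan : Submodule.span ℝ {u} = ⊤ := by
      rw [eq_top_iff]
      intro w _
      -- With `w` in place `i` and zero elsewhere, the difference is an arbitrary vector `w`.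
      have hw : (WithLp.toLp 2 (Pi.single i w) : Config N) ∈ p ⟨⟨⟨i, j⟩, hij⟩, b⟩ := by
        rw [h]; trivial
      have hji : j ≠ i := fun h => hij h.symm
      simpa [p, hji, ← hu] using hw
    have h1 := finrank_span_le_card (R := ℝ) ({u} : Set Plane)
    rw [hspan, finrank_top, finrank_euclideanSpace] at h1
    simp at h1
  have hne : (⋃ q, (p q : Set (Config N))) ≠ univ := fun h => by
    obtain ⟨q, hq⟩ := Subspace.exists_eq_top_of_iUnion_eq_univ h
    exact hp q hq
  obtain ⟨v, hv⟩ := (ne_univ_iff_exists_notMem _).1 hne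
  simp only [mem_iUnion, not_exists] at hv
  exact ⟨v, fun i j hij => ⟨hv ⟨⟨⟨i, j⟩, hij⟩, true⟩, hv ⟨⟨⟨i, j⟩, hij⟩, false⟩⟩⟩

theorem nonempty_domain : (domain N).Nonempty := by
  obtain ⟨v, hv⟩ := exists_sub_notMem_span (0 : Config N) 0
  exact ⟨v, fun i j hij h => (hv i j hij).1 (by simp [h])⟩

/-- A collision on the segment would make `v i - v j` a multiple of `x i - x j`, unless it occurs at
`x` itself. -/
theorem segment_subset_domain {x v : Config N} (hx : x ∈ domain N)
    (hv : ∀ i j, i ≠ j → v i - v j ∉ Submodule.span ℝ {x i - x j}) :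
    segment ℝ x v ⊆ domain N := by
  rintro _ ⟨a, b, ha, hb, hab, rfl⟩ i j hij h
  simp only [PiLp.add_apply, PiLp.smul_apply] at h
  have h1 : b • (v i - v j) = -a • (x i - x j) := by
    rw [← sub_eq_zero] at h ⊢
    rw [← h]
    module
  rcases eq_or_ne b 0 with rfl | hb0
  · have : a = 1 := by linarith
    rw [this, zero_smul, eq_comm, neg_smul, one_smul, neg_eq_zero, sub_eq_zero] at h1
    exact hx i j hij h1
  · apply hv i j hij
    rw [← Submodule.smul_mem_iff _ hb0, h1]
    exact Submodule.smul_mem _ _ (Submodule.mem_span_singleton_self _)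

theorem isPreconnected_of_segment_subset {E : Type*} [NormedAddCommGroup E] [NormedSpace ℝ E]
    {s : Set E} (h : ∀ x ∈ s, ∀ y ∈ s, ∃ v, segment ℝ x v ⊆ s ∧ segment ℝ y v ⊆ s) :
    IsPreconnected s := by
  refine isPreconnected_of_forall_pair fun x hx y hy => ?_
  obtain ⟨v, hxv, hyv⟩ := h x hx y hy
  have h1 : IsPreconnected (segment ℝ x v) := (convex_segment x v).isPreconnected
  have h2 : IsPreconnected (segment ℝ y v) := (convex_segment y v).isPreconnected
  exact ⟨segment ℝ x v ∪ segment ℝ y v, union_subset hxv hyv,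
    Or.inl (left_mem_segment ℝ x v), Or.inr (left_mem_segment ℝ y v),
    h1.union v (right_mem_segment ℝ x v) (right_mem_segment ℝ y v) h2⟩

theorem isPreconnected_domain : IsPreconnected (domain N) := by
  refine isPreconnected_of_segment_subset fun x hx y hy => ?_
  obtain ⟨v, hv⟩ := exists_sub_notMem_span x y
  exact ⟨v, segment_subset_domain hx fun i j h => (hv i j h).1,
    segment_subset_domain hy fun i j h => (hv i j h).2⟩

end Geometry

/-! ### Estimates on the energy -/

section Energy

open Real

variable {N : ℕ}

theorem interaction_eq (z : Plane) : interaction z = -(2 * Real.log ‖z‖) := by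
  rw [interaction, one_div, Real.log_inv, Real.log_pow]
  norm_num

/-- With a nonnegative inner product, adding `t • w` cannot shorten `(1 - t) • z`, whose norm is at
least `‖z‖ / 2`. -/
theorem interaction_segment_le {z w : Plane} (hz : z ≠ 0) (hzw : 0 ≤ inner ℝ z w) {t : ℝ}
    (ht : t ∈ Icc (0 : ℝ) (1 / 2)) :
    interaction (z + t • (w - z)) ≤ interaction z + 2 * Real.log 2 := by
  have hz0 : 0 < ‖z‖ := norm_pos_iff.2 hz
  have h1 : ‖z‖ ^ 2 ≤ (2 * ‖z + t • (w - z)‖) ^ 2 := by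
    have e : z + t • (w - z) = (1 - t) • z + t • w := by module
    have h2 : 1 / 2 ≤ 1 - t := by linarith [ht.2]
    rw [e, mul_pow, norm_add_sq_real, inner_smul_left, inner_smul_right, norm_smul,
      Real.norm_of_nonneg (by linarith)]
    have h3 : 0 ≤ (1 - t) * (t * inner ℝ z w) :=
      mul_nonneg (by linarith) (mul_nonneg ht.1 hzw)
    have h4 : (1 / 2) ^ 2 * ‖z‖ ^ 2 ≤ (1 - t) ^ 2 * ‖z‖ ^ 2 := by gcongr
    simp only [conj_trivial]
    nlinarith [sq_nonneg ‖t • w‖]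
  have h2 : ‖z‖ ≤ 2 * ‖z + t • (w - z)‖ := by
    rwa [sq_le_sq₀ (norm_nonneg _) (by positivity)] at h1
  have h3 : 0 < ‖z + t • (w - z)‖ := by linarith
  have h4 := Real.log_le_log hz0 h2
  rw [Real.log_mul two_ne_zero h3.ne'] at h4
  rw [interaction_eq, interaction_eq]
  linarith

/-- Linear growth suffices, being dominated by the Gaussian. It also holds at collisions, where
`Real.log 0 = 0`. -/
theorem neg_interaction_sub_le (x : Config N) (i j : Fin N) :
    -interaction (x i - x j) ≤ 4 * ‖x‖ := by
  rw [interaction_eq, neg_neg]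
  have h1 : Real.log ‖x i - x j‖ ≤ ‖x i - x j‖ := Real.log_le_self (norm_nonneg _)
  have h2 := norm_sub_le (x i) (x j)
  have h3 := PiLp.norm_apply_le x i
  have h4 := PiLp.norm_apply_le x j
  linarith

/-- The sum over ordered pairs with the normalization of the energy. -/
noncomputable def pairSum (N : ℕ) (F : Fin N → Fin N → ℝ) : ℝ :=
  1 / (2 * (N : ℝ) ^ 2) * ∑ i : Fin N, ∑ j ∈ Finset.univ.filter (fun j : Fin N => i ≠ j), F i j

theorem pairSum_le {F G : Fin N → Fin N → ℝ} (h : ∀ i j, i ≠ j → F i j ≤ G i j) :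
    pairSum N F ≤ pairSum N G := by
  unfold pairSum
  refine mul_le_mul_of_nonneg_left ?_ (by positivity)
  exact Finset.sum_le_sum fun i _ => Finset.sum_le_sum fun j hj =>
    h i j (Finset.mem_filter.1 hj).2

theorem pairSum_add (F G : Fin N → Fin N → ℝ) :
    pairSum N (fun i j => F i j + G i j) = pairSum N F + pairSum N G := by
  simp only [pairSum, Finset.sum_add_distrib, mul_add]

theorem pairSum_mul (F : Fin N → Fin N → ℝ) (r : ℝ) :
    pairSum N (fun i j => F i j * r) = pairSum N F * r := by
  simp only [pairSum, Finset.sum_mul, mul_assoc]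

theorem pairSum_neg (F : Fin N → Fin N → ℝ) :
    pairSum N (fun i j => -F i j) = -pairSum N F := by
  simp only [pairSum, Finset.sum_neg_distrib, mul_neg]

theorem energy_eq (x : Config N) :
    energy N x = 1 / N * ‖x‖ ^ 2 + pairSum N (fun i j => interaction (x i - x j)) := by
  rw [PiLp.norm_sq_eq_of_L2]
  rfl

theorem measurable_interaction : Measurable interaction := by
  unfold interaction
  fun_prop

theorem measurable_pairSum_interaction :
    Measurable fun x : Config N => pairSum N (fun i j => interaction (x i - x j)) := by
  unfold pairSum
  refine Measurable.const_mul (Finset.measurable_sum _ fun i _ =>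
    Finset.measurable_sum _ fun j _ => measurable_interaction.comp ?_) _
  exact Continuous.measurable (by fun_prop)

theorem measurable_energy : Measurable (energy N) := by
  have : energy N = fun x => 1 / N * ‖x‖ ^ 2 + pairSum N (fun i j => interaction (x i - x j)) :=
    funext energy_eq
  rw [this]
  exact (by fun_prop : Measurable fun x : Config N => 1 / (N : ℝ) * ‖x‖ ^ 2).add
    measurable_pairSum_interaction

theorem neg_pairSum_interaction_le (x : Config N) :
    -pairSum N (fun i j => interaction (x i - x j)) ≤ pairSum N (fun _ _ => 4) * ‖x‖ := by
  rw [← pairSum_neg, ← pairSum_mul]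
  exact pairSum_le fun i j _ => neg_interaction_sub_le x i j

theorem pairSum_interaction_segment_le {σ : Fin N → Fin N → SignType × SignType} {x y : Config N}
    (hx : x ∈ cell σ) (hy : y ∈ cell σ) {t : ℝ} (ht : t ∈ Icc (0 : ℝ) (1 / 2)) :
    pairSum N (fun i j => interaction ((y + t • (x - y)) i - (y + t • (x - y)) j)) ≤
      pairSum N (fun i j => interaction (y i - y j)) + pairSum N (fun _ _ => 2 * Real.log 2) := by
  rw [← pairSum_add]
  refine pairSum_le fun i j hij => ?_
  have hne : y i - y j ≠ 0 := fun h => zero_notMem_sector _ (h ▸ hy i j hij)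
  have := interaction_segment_le hne (inner_pos_of_mem_sector (hy i j hij) (hx i j hij)).le ht
  convert this using 2
  simp only [PiLp.add_apply, PiLp.smul_apply, PiLp.sub_apply]
  module

end Energy

end CoulombGas

/-! ### From double integrals to the variance -/

section Variance

open ENNReal

variable {E : Type*} [NormedAddCommGroup E] [NormedSpace ℝ E] [MeasurableSpace E]

theorem lintegral_lintegral_enorm_sub_sq {α : Type*} [MeasurableSpace α] {μ : Measure α}
    [IsProbabilityMeasure μ] {f : α → ℝ} (hf : Integrable f μ)
    (hf2 : Integrable (fun x => f x ^ 2) μ) :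
    ∫⁻ x, ∫⁻ y, ‖f x - f y‖ₑ ^ 2 ∂μ ∂μ =
      ENNReal.ofReal (2 * ((∫ x, f x ^ 2 ∂μ) - (∫ x, f x ∂μ) ^ 2)) := by
  have he : ∀ r : ℝ, ‖r‖ₑ ^ 2 = ENNReal.ofReal (r ^ 2) := fun r => by
    rw [← ofReal_norm, ← ENNReal.ofReal_pow (norm_nonneg _), Real.norm_eq_abs, sq_abs]
  set m := ∫ x, f x ∂μ with hm
  set S := ∫ x, f x ^ 2 ∂μ with hS
  have hexp : ∀ x y, (f x - f y) ^ 2 = f x ^ 2 - 2 * f x * f y + f y ^ 2 := fun x y => by ring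
  have hi : ∀ x, Integrable (fun y => (f x - f y) ^ 2) μ := fun x => by
    simp only [hexp]
    exact ((integrable_const _).sub (hf.const_mul _)).add hf2
  have hI : ∀ x, ∫ y, (f x - f y) ^ 2 ∂μ = f x ^ 2 - 2 * m * f x + S := fun x => by
    have hi1 : Integrable (fun y => f x ^ 2 - 2 * f x * f y) μ :=
      (integrable_const _).sub (hf.const_mul _)
    simp only [hexp]
    rw [integral_add hi1 hf2, integral_sub (integrable_const _) (hf.const_mul _),
      integral_const_mul]
    simp [← hm, ← hS]
    ring
  have h1 : ∀ x, ∫⁻ y, ‖f x - f y‖ₑ ^ 2 ∂μ = ENNReal.ofReal (f x ^ 2 - 2 * m * f x + S) :=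
    fun x => by
      simp only [he]
      rw [← ofReal_integral_eq_lintegral_ofReal (hi x) (ae_of_all _ fun _ => sq_nonneg _), hI]
  simp only [h1]
  have hi2 : Integrable (fun x => f x ^ 2 - 2 * m * f x) μ := hf2.sub (hf.const_mul _)
  have hi3 : Integrable (fun x => f x ^ 2 - 2 * m * f x + S) μ := hi2.add (integrable_const _)
  have hpos : ∀ x, 0 ≤ f x ^ 2 - 2 * m * f x + S := fun x => by
    rw [← hI x]
    exact integral_nonneg fun _ => sq_nonneg _
  rw [← ofReal_integral_eq_lintegral_ofReal hi3 (ae_of_all _ hpos),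
    integral_add hi2 (integrable_const _), integral_sub hf2 (hf.const_mul _), integral_const_mul,
    integral_const, probReal_univ, one_smul]
  congr 1
  ring

theorem PoincareRel.exists_variance_le [BorelSpace E] [SecondCountableTopology E] {μ : Measure E}
    [IsProbabilityMeasure μ] (h : PoincareRel μ Set.univ Set.univ) :
    ∃ c : ℝ, 0 < c ∧ ∀ f : E → ℝ, ContDiff ℝ 1 f → HasCompactSupport f →
      (∫ x, f x ^ 2 ∂μ) - (∫ x, f x ∂μ) ^ 2 ≤ c * ∫ x, ‖fderiv ℝ f x‖ ^ 2 ∂μ := by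
  obtain ⟨c, hc, H⟩ := h
  -- Adding 1 only serves to make the constant positive.
  refine ⟨c.toReal + 1, add_pos_of_nonneg_of_pos ENNReal.toReal_nonneg one_pos, fun f hf hs => ?_⟩
  have hfi : Integrable f μ := hf.continuous.integrable_of_hasCompactSupport hs
  have hs2 : HasCompactSupport (fun x => f x ^ 2) :=
    hs.mono fun x hx => by simpa using hx
  have hf2 : Integrable (fun x => f x ^ 2) μ :=
    (hf.continuous.pow 2).integrable_of_hasCompactSupport hs2
  have hds : HasCompactSupport (fun x => ‖fderiv ℝ f x‖ ^ 2) :=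
    (hs.fderiv ℝ).mono fun x hx => by simpa using hx
  have hdc : Continuous (fun x => ‖fderiv ℝ f x‖ ^ 2) :=
    (hf.continuous_fderiv one_ne_zero).norm.pow 2
  have hd : Integrable (fun x => ‖fderiv ℝ f x‖ ^ 2) μ := hdc.integrable_of_hasCompactSupport hds
  have h1 := H f hf
  simp only [Measure.restrict_univ] at h1
  rw [lintegral_lintegral_enorm_sub_sq hfi hf2] at h1
  have h2 : ∫⁻ x, ‖fderiv ℝ f x‖ₑ ^ 2 ∂μ = ENNReal.ofReal (∫ x, ‖fderiv ℝ f x‖ ^ 2 ∂μ) := by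
    rw [ofReal_integral_eq_lintegral_ofReal hd (ae_of_all _ fun _ => sq_nonneg _)]
    refine lintegral_congr fun x => ?_
    rw [ENNReal.ofReal_pow (norm_nonneg _), ofReal_norm]
  have h3 : 0 ≤ ∫ x, ‖fderiv ℝ f x‖ ^ 2 ∂μ := integral_nonneg fun _ => sq_nonneg _
  rw [h2, ← ENNReal.ofReal_toReal hc, ← ENNReal.ofReal_mul ENNReal.toReal_nonneg,
    ENNReal.ofReal_le_ofReal_iff (by positivity)] at h1
  have h4 : 0 ≤ c.toReal * ∫ x, ‖fderiv ℝ f x‖ ^ 2 ∂μ := by positivity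
  linarith

end Variance

/-! ### Gaussian integrability -/

section Gaussian

open Real

theorem integrable_exp_add_sub_sq {E : Type*} [NormedAddCommGroup E] [InnerProductSpace ℝ E]
    [FiniteDimensional ℝ E] [MeasurableSpace E] [BorelSpace E] (K B : ℝ) {b : ℝ} (hb : 0 < b) :
    Integrable fun x : E => exp (K + B * ‖x‖ - b * ‖x‖ ^ 2) := by
  have h0 : Integrable fun x : E => exp (-(b / 2) * ‖x‖ ^ 2) := by
    have h := (GaussianFourier.integrable_cexp_neg_mul_sq_norm_add (V := E) (b := (b / 2 : ℝ))
      (by simpa using hb) 0 0).norm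
    refine h.congr (ae_of_all _ fun x => ?_)
    simp only [Complex.norm_exp, zero_mul, add_zero]
    congr 1
    norm_cast
  refine (h0.const_mul (exp (K + B ^ 2 / (2 * b)))).mono' (by fun_prop) (ae_of_all _ fun x => ?_)
  rw [norm_of_nonneg (exp_pos _).le, ← exp_add, exp_le_exp]
  -- Completing the square absorbs the linear term into half of the Gaussian.
  have h1 : B ^ 2 / (2 * b) + b / 2 * ‖x‖ ^ 2 - B * ‖x‖ = (B - b * ‖x‖) ^ 2 / (2 * b) := by
    field_simp
    ring
  have h2 : 0 ≤ (B - b * ‖x‖) ^ 2 / (2 * b) := by positivity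
  linarith

theorem two_mul_sq_add_le_mul_exp {r k : ℝ} (hr : 0 ≤ r) (hk : 0 ≤ k) :
    2 * r ^ 2 + k ≤ (4 + k) * exp r := by
  have h1 := quadratic_le_exp_of_nonneg hr
  nlinarith [one_le_exp hr]

end Gaussian

/-! ### The Boltzmann–Gibbs measure -/

namespace CoulombGas

open Set Real

variable {N : ℕ} {β : ℝ}

theorem neg_mul_energy_eq (x : Config N) :
    -β * energy N x =
      -β * pairSum N (fun i j => interaction (x i - x j)) - β / N * ‖x‖ ^ 2 := by
  rw [energy_eq]
  ring

theorem integrable_exp_neg_energy (hN : 2 ≤ N) (hβ : 0 < β) :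
    Integrable fun x => exp (-β * energy N x) := by
  have hN0 : (0 : ℝ) < N := by positivity
  refine (integrable_exp_add_sub_sq 0 (β * pairSum N (fun _ _ => 4)) (div_pos hβ hN0)).mono'
    (measurable_energy.const_mul _).exp.aestronglyMeasurable (ae_of_all _ fun x => ?_)
  rw [norm_of_nonneg (exp_pos _).le, exp_le_exp, neg_mul_energy_eq]
  have := mul_le_mul_of_nonneg_left (neg_pairSum_interaction_le x) hβ.le
  linarith

theorem partitionFunction_pos (hN : 2 ≤ N) (hβ : 0 < β) : 0 < partitionFunction N β := by
  rw [partitionFunction, setIntegral_pos_iff_support_of_nonneg_ae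
    (ae_of_all _ fun x => (exp_pos _).le) (integrable_exp_neg_energy hN hβ).integrableOn]
  have : Function.support (fun x : Config N => exp (-β * energy N x)) = univ :=
    Function.support_eq_univ fun x => (exp_pos _).ne'
  rw [this, univ_inter]
  exact isOpen_domain.measure_pos _ nonempty_domain

theorem isProbabilityMeasure_boltzmannGibbs (hN : 2 ≤ N) (hβ : 0 < β) :
    IsProbabilityMeasure (boltzmannGibbs N β) := by
  have hZ := partitionFunction_pos hN hβ
  refine ⟨?_⟩
  rw [boltzmannGibbs, withDensity_apply _ MeasurableSet.univ, Measure.restrict_univ,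
    ← ofReal_integral_eq_lintegral_ofReal
      ((integrable_exp_neg_energy hN hβ).integrableOn.div_const _)
      (ae_of_all _ fun x => div_nonneg (exp_pos _).le hZ.le), integral_div]
  rw [← partitionFunction, div_self hZ.ne', ENNReal.ofReal_one]

/-- The logarithm of the density, without its Gaussian factor. -/
noncomputable def logWeight (N : ℕ) (β : ℝ) (x : Config N) : ℝ :=
  -β * pairSum N (fun i j => interaction (x i - x j)) - Real.log (partitionFunction N β)

theorem boltzmannGibbs_eq (hN : 2 ≤ N) (hβ : 0 < β) :
    boltzmannGibbs N β = (volume.restrict (domain N)).withDensity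
      fun x => ENNReal.ofReal (exp (logWeight N β x - β / N * ‖x‖ ^ 2)) := by
  unfold boltzmannGibbs
  congr 1
  funext x
  rw [neg_mul_energy_eq, logWeight, sub_right_comm, exp_sub _ (Real.log _),
    exp_log (partitionFunction_pos hN hβ)]

theorem measurable_logWeight : Measurable (logWeight N β) :=
  (measurable_pairSum_interaction.const_mul _).sub_const _

theorem logWeight_le (hβ : 0 < β) (x : Config N) : logWeight N β x ≤
    β * pairSum N (fun _ _ => 4) * ‖x‖ - Real.log (partitionFunction N β) := by
  have := mul_le_mul_of_nonneg_left (neg_pairSum_interaction_le x) hβ.le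
  unfold logWeight
  linarith

theorem logWeight_le_segment (hβ : 0 < β) {σ : Fin N → Fin N → SignType × SignType}
    {x y : Config N} (hx : x ∈ cell σ) (hy : y ∈ cell σ) {t : ℝ} (ht : t ∈ Icc (0 : ℝ) (1 / 2)) :
    logWeight N β y ≤
      logWeight N β (y + t • (x - y)) + β * pairSum N (fun _ _ => 2 * Real.log 2) := by
  have := mul_le_mul_of_nonneg_left (pairSum_interaction_segment_le hx hy ht) hβ.le
  unfold logWeight
  linarith

theorem poincareRel_cell (hN : 2 ≤ N) (hβ : 0 < β) (σ : Fin N → Fin N → SignType × SignType) :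
    PoincareRel (boltzmannGibbs N β) (cell σ) (cell σ) := by
  have hN0 : (0 : ℝ) < N := by positivity
  have ha : 0 < β / N := div_pos hβ hN0
  set M := β * pairSum N (fun _ _ => 2 * Real.log 2) with hM
  have hsub : cell σ ⊆ domain N := domain_eq_iUnion_cell (N := N) ▸ subset_iUnion cell σ
  have hμ : (boltzmannGibbs N β).restrict (cell σ) = (volume.restrict (cell σ)).withDensity
      fun x => ENNReal.ofReal (exp (logWeight N β x - β / N * ‖x‖ ^ 2)) := by
    rw [boltzmannGibbs_eq hN hβ, restrict_withDensity (isOpen_cell σ).measurableSet,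
      Measure.restrict_restrict_of_subset hsub]
  have hG : ∫⁻ x : Config N, ENNReal.ofReal ((2 * ‖x‖ ^ 2 + 4 / (β / N)) *
      exp (logWeight N β x + M - β / N / 2 * ‖x‖ ^ 2)) ≠ ⊤ := by
    -- The `+ 1` in the linear coefficient pays for the polynomial factor, bounded by a multiple of
    -- `exp ‖x‖`.
    have hi := (integrable_exp_add_sub_sq (E := Config N)
      (M - Real.log (partitionFunction N β)) (β * pairSum N (fun _ _ => 4) + 1)
      (half_pos ha)).const_mul (4 + 4 / (β / N))
    refine ne_top_of_le_ne_top hi.lintegral_lt_top.ne (lintegral_mono fun x => ?_)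
    apply ENNReal.ofReal_le_ofReal
    have h1 := two_mul_sq_add_le_mul_exp (norm_nonneg x) (by positivity : 0 ≤ 4 / (β / N))
    calc _ ≤ (4 + 4 / (β / N)) * exp ‖x‖ *
          exp (logWeight N β x + M - β / N / 2 * ‖x‖ ^ 2) := by gcongr
      _ ≤ _ := by
          rw [mul_assoc, ← exp_add]
          have := logWeight_le hβ x
          gcongr
          linarith
  refine ⟨4 * ((∫⁻ x : Config N, ENNReal.ofReal ((2 * ‖x‖ ^ 2 + 4 / (β / N)) *
    exp (logWeight N β x + M - β / N / 2 * ‖x‖ ^ 2))) * 2 ^ Module.finrank ℝ (Config N)),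
    ?_, fun f hf => (lintegral_enorm_sub_sq_le_of_convex (isOpen_cell σ).measurableSet
    (convex_cell σ) measurable_logWeight ha
    (fun x hx y hy t ht => logWeight_le_segment hβ hx hy ht) hμ hf).trans ?_⟩
  · finiteness
  · rw [mul_assoc, mul_assoc]
    gcongr
    exact Measure.restrict_le_self

theorem ae_mem_domain : ∀ᵐ x ∂boltzmannGibbs N β, x ∈ domain N :=
  (withDensity_absolutelyContinuous _ _).ae_le (ae_restrict_mem isOpen_domain.measurableSet)

theorem boltzmannGibbs_ne_zero (hN : 2 ≤ N) (hβ : 0 < β) {U : Set (Config N)}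
    (hU : U ⊆ domain N) (ho : IsOpen U) (hne : U.Nonempty) : boltzmannGibbs N β U ≠ 0 := by
  intro h
  have hm := measurable_logWeight (N := N) (β := β)
  rw [boltzmannGibbs_eq hN hβ, withDensity_apply _ ho.measurableSet,
    Measure.restrict_restrict_of_subset hU,
    setLIntegral_eq_zero_iff ho.measurableSet (by fun_prop)] at h
  have h0 : volume U = 0 := by
    refine measure_mono_null (fun x hx => ?_) h
    simpa [hx] using exp_pos _
  exact (ho.measure_pos _ hne).ne' h0

theorem poincareRel_boltzmannGibbs (hN : 2 ≤ N) (hβ : 0 < β) :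
    PoincareRel (boltzmannGibbs N β) univ univ := by
  have := isProbabilityMeasure_boltzmannGibbs hN hβ
  obtain ⟨c, hc, H⟩ := PoincareRel.of_isPreconnected (μ := boltzmannGibbs N β)
    isPreconnected_domain isOpen_cell domain_eq_iUnion_cell
    (fun U hU ho hne => boltzmannGibbs_ne_zero hN hβ hU ho hne) (poincareRel_cell hN hβ)
  refine ⟨c, hc, fun f hf => ?_⟩
  have := H f hf
  rw [Measure.restrict_eq_self_of_ae_mem ae_mem_domain] at this
  simpa only [Measure.restrict_univ] using this

/-! ### Extension of test functions by zero -/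

section TestFunctions

variable {E : Type*} {S : Set E} {f : E → ℝ}

theorem support_indicator_eq : Function.support (S.indicator f) = {x | x ∈ S ∧ f x ≠ 0} := by
  ext x
  simp

/-- Off `S` the extension vanishes in a neighbourhood, since its closed support lies in `S`. -/
theorem contDiff_indicator_of_mem_testFunctions [NormedAddCommGroup E] [NormedSpace ℝ E] (hS : IsOpen S)
    (hf : f ∈ testFunctions S) : ContDiff ℝ ∞ (S.indicator f) := by
  rw [contDiff_iff_contDiffAt]
  intro x
  by_cases hx : x ∈ S
  · exact (hf.1.contDiffAt (hS.mem_nhds hx)).congr_of_eventuallyEq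
      (Filter.eventuallyEq_of_mem (hS.mem_nhds hx) fun y hy => indicator_of_mem hy f)
  · have hx' : x ∉ tsupport (S.indicator f) := by
      rw [tsupport, support_indicator_eq]
      exact fun h => hx (hf.2.2 h)
    exact contDiffAt_const.congr_of_eventuallyEq (notMem_tsupport_iff_eventuallyEq.1 hx')

theorem hasCompactSupport_indicator_of_mem_testFunctions [NormedAddCommGroup E] [NormedSpace ℝ E]
    (hf : f ∈ testFunctions S) : HasCompactSupport (S.indicator f) := by
  rw [HasCompactSupport, tsupport, support_indicator_eq]
  exact hf.2.1

theorem norm_gradient_eq_of_mem [NormedAddCommGroup E] [InnerProductSpace ℝ E] [CompleteSpace E]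
    (hS : IsOpen S) {x : E} (hx : x ∈ S) : ‖gradient f x‖ = ‖fderiv ℝ (S.indicator f) x‖ := by
  have h : S.indicator f =ᶠ[nhds x] f :=
    Filter.eventuallyEq_of_mem (hS.mem_nhds hx) fun y hy => indicator_of_mem hy f
  rw [h.fderiv_eq, gradient, LinearIsometryEquiv.norm_map]

end TestFunctions

end CoulombGas

open CoulombGas in
theorem theorem1p3 (N : ℕ) (hN : 2 ≤ N) (β : ℝ) (hβ : 0 < β) :
    IsProbabilityMeasure (CoulombGas.boltzmannGibbs N β) ∧
      ∃ c : ℝ, 0 < c ∧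
        CoulombGas.SatisfiesPoincare (CoulombGas.boltzmannGibbs N β)
          (CoulombGas.testFunctions (CoulombGas.domain N)) c := by
  have hP := isProbabilityMeasure_boltzmannGibbs hN hβ
  refine ⟨hP, ?_⟩
  obtain ⟨c, hc, H⟩ := (poincareRel_boltzmannGibbs hN hβ).exists_variance_le
  refine ⟨c, hc, fun f hf => ?_⟩
  have h := H _ ((contDiff_indicator_of_mem_testFunctions isOpen_domain hf).of_le (by simp))
    (hasCompactSupport_indicator_of_mem_testFunctions hf)
  have hae : ∀ᵐ x ∂boltzmannGibbs N β, (domain N).indicator f x = f x :=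
    ae_mem_domain.mono fun x hx => Set.indicator_of_mem hx f
  rwa [integral_congr_ae (hae.mono fun x hx => by simp only [hx] :
      (fun x => (domain N).indicator f x ^ 2) =ᵐ[_] fun x => f x ^ 2), integral_congr_ae hae,
    integral_congr_ae (ae_mem_domain.mono fun x hx => by
      simp only [norm_gradient_eq_of_mem (f := f) isOpen_domain hx] :
      (fun x => ‖fderiv ℝ ((domain N).indicator f) x‖ ^ 2) =ᵐ[_] fun x => ‖gradient f x‖ ^ 2)]
    at h
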